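/- A function $\psi:[0,\infty)\to[0,\infty)$ is called a Bernstein function if it is continuous on $[0,\infty)$, smooth on $(0,\infty)$, and $(-1)^k\psi^{(k)}(x)\le 0$ for all integers $k\ge1$ and all $x>0$. Let $0<\alpha<2$ and let $\psi$ be a Bernstein function with $\psi(0)=0$ and $\psi(1)=1$ which is regularly varying at $0$ of index $\alpha/2$, that is, $\psi(x)=x^{\alpha/2}\ell(1/x)$ for all sufficiently small $x>0$, where $\lim_{x\to\infty}\ell(\lambda x)/\ell(x)=1$ for each $\lambda>0$. Then there are constants $a,b\ge 0$ and a measure $\nu$ on $[0,\infty)$ with $\int_{[0,\infty)}\min\{1,s\}\,d\nu(s)<\infty$ such that $$\psi(x)=a+bx+\int_{[0,\infty)}\bigl(1-e^{-xs}\bigr)\,d\nu(s),\qquad x\ge0 .$$ For any such $a,b,\nu$ put, for integers $k\ge1$, $$c(\psi,k)=\frac1{k!}\int_{[0,\infty)}t^ke^{-t}\,d\nu(t)+\begin{cases}b&\text{if }k=1,\\0&\text{otherwise,}\end{cases}$$ let $R_1,R_2,\dots$ be independent random variables with values in the non-negative integers and with $\mathbb P(R_i=k)=c(\psi,k)$ for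 all $i\ge 1$ and $k\ge1$, and let $\tau_n=R_1+\dots+R_n$ be the associated discrete subordinator. Then, as $n\to\infty$ ($n\in\mathbb N$) and $t\to\infty$ ($t\in\mathbb R$) in such a way that $n\psi(1/t)\to0$, $$\mathbb P(\tau_n>t)\sim\frac{n\,\psi(1/t)}{\Gamma(1-\alpha/2)} .$$ That is, for every $\varepsilon>0$ there are $N$, $T$ and $\delta>0$ such that $\left|\dfrac{\Gamma(1-\alpha/2)\,\mathbb P(\tau_n>t)}{n\psi(1/t)}-1\right|\le\varepsilon$ whenever $n\ge N$, $t\ge T$ and $n\psi(1/t)<\delta$. -/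

import Mathlib

open Set Filter Topology MeasureTheory ProbabilityTheory
open scoped NNReal

/-- A Bernstein function on `[0, ∞)`: continuous on `[0, ∞)`, smooth on `(0, ∞)`, non-negative, with
`(-1)^n ψ^(n)(x) ≤ 0` for all `n ≥ 1` and `x > 0`. Only the values of `ψ` on `[0, ∞)` matter. -/
structure IsBernstein (ψ : ℝ → ℝ) : Prop where
  continuousOn : ContinuousOn ψ (Ici 0)
  contDiffOn : ContDiffOn ℝ (⊤ : ℕ∞) ψ (Ioi 0)
  nonneg : ∀ x : ℝ, 0 ≤ x → 0 ≤ ψ x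
  sign : ∀ n : ℕ, 1 ≤ n → ∀ x : ℝ, 0 < x → (-1 : ℝ) ^ n * iteratedDeriv n ψ x ≤ 0

/-- `ℓ` varies slowly at infinity. -/
def IsSlowlyVarying (ℓ : ℝ → ℝ) : Prop :=
  ∀ c : ℝ, 0 < c → Tendsto (fun x : ℝ => ℓ (c * x) / ℓ x) atTop (𝓝 1)

/-- `f` varies regularly at zero with index `β`: near zero `f x = x ^ β * ℓ (1 / x)` for a function
`ℓ` that varies slowly at infinity. -/
def IsRegularlyVaryingAtZero (f : ℝ → ℝ) (β : ℝ) : Prop :=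
  ∃ ℓ : ℝ → ℝ, IsSlowlyVarying ℓ ∧
    ∃ r : ℝ, 0 < r ∧ ∀ x : ℝ, 0 < x → x < r → f x = x ^ β * ℓ (1 / x)

/-- The constants `a, b ≥ 0` and the measure `ν` on `[0, ∞)` with `∫ min(1, s) dν(s) < ∞` represent
`ψ` as `ψ x = a + b x + ∫ (1 - e^(-x s)) dν(s)`. -/
structure IsLevyTriple (ψ : ℝ → ℝ) (a b : ℝ) (ν : Measure ℝ≥0) : Prop where
  a_nonneg : 0 ≤ a
  b_nonneg : 0 ≤ b
  integrable : Integrable (fun s : ℝ≥0 => min 1 (s : ℝ)) ν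
  eq : ∀ x : ℝ, 0 ≤ x → ψ x = a + b * x + ∫ s : ℝ≥0, (1 - Real.exp (-(x * s))) ∂ν

/-- The numbers `c(ψ, k)`, `k ≥ 1`, in terms of the drift `b` and the measure `ν` of `ψ`. -/
noncomputable def subordinationCoeff (b : ℝ) (ν : Measure ℝ≥0) (k : ℕ) : ℝ :=
  1 / (k.factorial : ℝ) * (∫ t : ℝ≥0, (t : ℝ) ^ k * Real.exp (-(t : ℝ)) ∂ν) +
    if k = 1 then b else 0

/-- `R 0, R 1, …` are independent random variables, each with `ℙ(R i = k) = c k` for `k ≥ 1`. -/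
structure IsIIDSteps {Ω : Type*} [MeasurableSpace Ω] (P : Measure Ω) (c : ℕ → ℝ)
    (R : ℕ → Ω → ℕ) : Prop where
  measurable : ∀ i : ℕ, Measurable (R i)
  indep : iIndepFun R P
  law : ∀ i k : ℕ, 1 ≤ k → P.real {ω | R i ω = k} = c k

/-- The discrete subordinator `τ n`, the sum of the first `n` steps. -/
def discreteSubordinator {Ω : Type*} (R : ℕ → Ω → ℕ) (n : ℕ) (ω : Ω) : ℕ :=
  ∑ i ∈ Finset.range n, R i ω

/-! Put `β = α / 2`. The coefficients `c(ψ, k)` have generating function `1 - ψ (1 - s)`, so `τ n`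
has Laplace transform `(1 - ψ (1 - exp (-c))) ^ n`, and the tail `u ↦ ℙ(τ n > t u)` has Laplace
transform `(1 - (1 - ψ (1 - exp (-c / t))) ^ n) / c`. When `n ψ (1 / t) → 0` this is asymptotic to
`n ψ (c / t) / c`, hence to `c ^ (β - 1) * n ψ (1 / t)` by regular variation
(`IsLevyTriple.tendsto_one_sub_pow`). Since `c ^ (β - 1)` is the Laplace transform of `u ^ (-β) /
Γ(1 - β)` and tails are monotone, the Tauberian theorem `tendsto_of_tendsto_laplace` gives
convergence of the normalised tail at `u = 1`. It works along any filter, so the joint limit in `(n,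
t)` needs no uniformity argument.

The Lévy triple comes from Taylor's formula. The Taylor series of `ψ` at `y` converges on `(0, y)`
and has terms of one sign, which makes `x ↦ ψ (y (1 - exp (-x / y)))` a mixture of the functions `(1
- w ^ x) / (1 - w)`, `w ∈ [0, 1]`. The mixing measures have bounded mass, and compactness yields a
mixture for `ψ` as `y → ∞`. Substituting `w = exp (-s)` gives `ν`, while the atom at `w = 1` is the
drift. -/

/-! ### A Tauberian theorem for monotone functions -/

section Tauberian

/-- Convergence of all moments of densities in a `[0, 1]`-valued variable implies convergence of the
integrals of all continuous functions of that variable. -/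
theorem tendsto_integral_mul_of_tendsto_moments {ι X : Type*} [MeasurableSpace X] {μ : Measure X}
    {L : Filter ι} {w : X → ℝ} (hw : Measurable w) (hw01 : ∀ᵐ x ∂μ, w x ∈ Icc (0 : ℝ) 1)
    {D : ι → X → ℝ} {E : X → ℝ} (hD : ∀ i, Integrable (D i) μ) (hE : Integrable E μ)
    (hD0 : ∀ i, 0 ≤ᵐ[μ] D i) (hE0 : 0 ≤ᵐ[μ] E)
    (hmom : ∀ k : ℕ, Tendsto (fun i => ∫ x, w x ^ k * D i x ∂μ) L (𝓝 (∫ x, w x ^ k * E x ∂μ)))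
    {g : ℝ → ℝ} (hg : Continuous g) :
    Tendsto (fun i => ∫ x, g (w x) * D i x ∂μ) L (𝓝 (∫ x, g (w x) * E x ∂μ)) := by
  have hint : ∀ (f : ℝ → ℝ), Continuous f → ∀ A : X → ℝ, Integrable A μ →
      Integrable (fun x => f (w x) * A x) μ := by
    intro f hf A hA
    obtain ⟨C, hC⟩ := (isCompact_Icc (a := (0 : ℝ)) (b := 1)).exists_bound_of_continuousOn
      hf.continuousOn
    refine hA.bdd_mul (c := C) (hf.measurable.comp hw).aestronglyMeasurable ?_
    filter_upwards [hw01] with x hx using hC _ hx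
  have hpoly : ∀ p : Polynomial ℝ,
      Tendsto (fun i => ∫ x, p.eval (w x) * D i x ∂μ) L (𝓝 (∫ x, p.eval (w x) * E x ∂μ)) := by
    intro p
    induction p using Polynomial.induction_on' with
    | add p q hp hq =>
      have := hp.add hq
      simp only [Polynomial.eval_add, add_mul]
      rw [integral_add (hint _ p.continuous _ hE) (hint _ q.continuous _ hE)]
      refine this.congr fun i => ?_
      rw [integral_add (hint _ p.continuous _ (hD i)) (hint _ q.continuous _ (hD i))]
    | monomial n a =>
      simp only [Polynomial.eval_monomial, mul_assoc, integral_const_mul]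
      exact (hmom n).const_mul a
  have hbound : ∀ (p : Polynomial ℝ) (ε : ℝ), (∀ x ∈ Icc (0 : ℝ) 1, |p.eval x - g x| < ε) →
      ∀ A : X → ℝ, Integrable A μ → 0 ≤ᵐ[μ] A →
      |∫ x, g (w x) * A x ∂μ - ∫ x, p.eval (w x) * A x ∂μ| ≤ ε * ∫ x, A x ∂μ := by
    intro p ε hp A hA hA0
    rw [← integral_sub (hint _ hg _ hA) (hint _ p.continuous _ hA), ← integral_const_mul,
      ← Real.norm_eq_abs]
    refine norm_integral_le_of_norm_le (hA.const_mul ε) ?_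
    filter_upwards [hw01, hA0] with x hx hx0
    rw [← sub_mul, norm_mul, Real.norm_of_nonneg hx0, Real.norm_eq_abs, abs_sub_comm]
    exact mul_le_mul_of_nonneg_right (hp _ hx).le hx0
  have hmass : Tendsto (fun i => ∫ x, D i x ∂μ) L (𝓝 (∫ x, E x ∂μ)) := by
    simpa using hmom 0
  have hE0' : 0 ≤ ∫ x, E x ∂μ := integral_nonneg_of_ae hE0
  rw [Metric.tendsto_nhds]
  intro ε hε
  set M := ∫ x, E x ∂μ
  -- The masses are eventually at most `M + 1`, so replacing `g` by `p` costs at most `ε / 3` on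
  -- each side.
  obtain ⟨p, hp⟩ := exists_polynomial_near_of_continuousOn 0 1 g hg.continuousOn
    (ε / (3 * (M + 1))) (by positivity)
  filter_upwards [Metric.tendsto_nhds.1 (hpoly p) (ε / 3) (by positivity),
    hmass.eventually_le_const (show M < M + 1 by linarith)] with i hi hm
  rw [Real.dist_eq] at hi ⊢
  have h1 := hbound p _ hp _ (hD i) (hD0 i)
  have h2 := hbound p _ hp _ hE hE0
  have h3 : ∀ m, m ≤ M + 1 → ε / (3 * (M + 1)) * m ≤ ε / 3 := by
    intro m hm
    calc ε / (3 * (M + 1)) * m ≤ ε / (3 * (M + 1)) * (M + 1) := by gcongr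
      _ = ε / 3 := by field_simp
  have h1' := abs_le.1 (h1.trans (h3 _ hm))
  have h2' := abs_le.1 (h2.trans (h3 _ (by linarith)))
  have h4 := abs_lt.1 hi
  rw [abs_lt]
  constructor <;> linarith [h1'.1, h1'.2, h2'.1, h2'.2, h4.1, h4.2]

/-- The tent function with support `[p, q]`. -/
noncomputable def tent (p q u : ℝ) : ℝ := max 0 (min (u - p) (q - u))

theorem continuous_tent (p q : ℝ) : Continuous (tent p q) := by
  unfold tent; fun_prop

theorem tent_nonneg (p q u : ℝ) : 0 ≤ tent p q u := le_max_left _ _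

theorem tent_eq_zero {p q u : ℝ} (h : u ∉ Ioo p q) : tent p q u = 0 := by
  unfold tent
  rw [max_eq_left]
  by_contra! h'
  exact h ⟨by linarith [(lt_min_iff.1 h').1], by linarith [(lt_min_iff.1 h').2]⟩

theorem integral_tent_pos {p q : ℝ} (hp : 0 < p) (hpq : p < q) :
    0 < ∫ u in Ioi 0, tent p q u := by
  have hint : Integrable (tent p q) :=
    (continuous_tent p q).integrable_of_hasCompactSupport <|
      HasCompactSupport.intro (isCompact_Icc (a := p) (b := q)) fun u hu =>
        tent_eq_zero fun h => hu ⟨h.1.le, h.2.le⟩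
  rw [setIntegral_pos_iff_support_of_nonneg_ae (ae_of_all _ (tent_nonneg p q))
    hint.integrableOn]
  have : Ioo p q ⊆ Function.support (tent p q) ∩ Ioi 0 := by
    intro u hu
    refine ⟨ne_of_gt ?_, hp.trans hu.1⟩
    exact lt_max_of_lt_right (lt_min (by linarith [hu.1]) (by linarith [hu.2]))
  refine lt_of_lt_of_le ?_ (measure_mono this)
  simp [hpq]

/-- Pointwise convergence of Laplace transforms at the positive integers implies convergence of the
integrals against continuous functions that vanish for large arguments. -/
theorem tendsto_integral_mul_of_tendsto_laplace {ι : Type*} {L : Filter ι} {F : ι → ℝ → ℝ}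
    {G : ℝ → ℝ} (hF0 : ∀ i u, 0 < u → 0 ≤ F i u) (hG0 : ∀ u, 0 < u → 0 ≤ G u)
    (hF : ∀ i, IntegrableOn (fun u => Real.exp (-u) * F i u) (Ioi 0))
    (hG : IntegrableOn (fun u => Real.exp (-u) * G u) (Ioi 0))
    (hlap : ∀ k : ℕ, Tendsto (fun i => ∫ u in Ioi 0, Real.exp (-((k + 1 : ℕ) * u)) * F i u) L
      (𝓝 (∫ u in Ioi 0, Real.exp (-((k + 1 : ℕ) * u)) * G u)))
    {h : ℝ → ℝ} (hh : Continuous h) {M : ℝ} (hM : ∀ u, M ≤ u → h u = 0) :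
    Tendsto (fun i => ∫ u in Ioi 0, h u * F i u) L (𝓝 (∫ u in Ioi 0, h u * G u)) := by
  -- In the variable `w = exp (-u)`, `h u = g w * w`. Cutting off at `exp (-M)` keeps `g` continuous
  -- at `0` and changes nothing, as `h` vanishes beyond `M`.
  set g : ℝ → ℝ := fun w =>
    h (-Real.log (max w (Real.exp (-M)))) / max w (Real.exp (-M)) with hg
  have hpos : ∀ w, 0 < max w (Real.exp (-M)) := fun w =>
    lt_max_of_lt_right (Real.exp_pos _)
  have hgc : Continuous g := by
    have hm : Continuous fun w : ℝ => max w (Real.exp (-M)) := by fun_prop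
    exact (hh.comp (hm.log fun w => (hpos w).ne').neg).div hm fun w => (hpos w).ne'
  have hgh : ∀ u, g (Real.exp (-u)) * Real.exp (-u) = h u := by
    intro u
    simp only [hg]
    rcases le_total u M with hu | hu
    · rw [max_eq_left (Real.exp_le_exp.2 (by linarith)), Real.log_exp, neg_neg,
        div_mul_cancel₀ _ (Real.exp_pos _).ne']
    · rw [max_eq_right (Real.exp_le_exp.2 (by linarith)), Real.log_exp, neg_neg, hM M le_rfl,
        hM u hu]
      simp
  have key := tendsto_integral_mul_of_tendsto_moments (μ := volume.restrict (Ioi (0 : ℝ)))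
    (L := L) (w := fun u => Real.exp (-u)) (D := fun i u => Real.exp (-u) * F i u)
    (E := fun u => Real.exp (-u) * G u) (by fun_prop)
    (by
      filter_upwards [ae_restrict_mem measurableSet_Ioi] with u hu
      exact ⟨(Real.exp_pos _).le, Real.exp_le_one_iff.2 (by linarith [mem_Ioi.1 hu])⟩)
    hF hG
    (fun i => by
      filter_upwards [ae_restrict_mem measurableSet_Ioi] with u hu
      exact mul_nonneg (Real.exp_pos _).le (hF0 i u hu))
    (by
      filter_upwards [ae_restrict_mem measurableSet_Ioi] with u hu
      exact mul_nonneg (Real.exp_pos _).le (hG0 u hu))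
    -- One factor `exp (-u)` belongs to the density, so the moment of order `k` is the Laplace
    -- transform at `k + 1`.
    (fun k => by
      have : ∀ u : ℝ, ∀ c : ℝ, Real.exp (-u) ^ k * (Real.exp (-u) * c) =
          Real.exp (-((k + 1 : ℕ) * u)) * c := by
        intro u c
        rw [← mul_assoc, ← Real.exp_nat_mul, ← Real.exp_add]
        push_cast
        ring_nf
      simp only [this]
      exact hlap k) hgc
  simpa only [← mul_assoc, hgh] using key

/-- A Tauberian theorem: if the Laplace transforms of non-increasing functions `F i` converge to
that of a non-increasing function `G`, then `F i` converges to `G` where `G` is continuous. -/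
theorem tendsto_of_tendsto_laplace {ι : Type*} {L : Filter ι} {F : ι → ℝ → ℝ}
    {G : ℝ → ℝ} (hF0 : ∀ i u, 0 < u → 0 ≤ F i u) (hG0 : ∀ u, 0 < u → 0 ≤ G u)
    (hFa : ∀ i, AntitoneOn (F i) (Ioi 0)) (hGa : AntitoneOn G (Ioi 0))
    (hF : ∀ i, IntegrableOn (fun u => Real.exp (-u) * F i u) (Ioi 0))
    (hG : IntegrableOn (fun u => Real.exp (-u) * G u) (Ioi 0))
    (hlap : ∀ k : ℕ, Tendsto (fun i => ∫ u in Ioi 0, Real.exp (-((k + 1 : ℕ) * u)) * F i u) L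
      (𝓝 (∫ u in Ioi 0, Real.exp (-((k + 1 : ℕ) * u)) * G u)))
    {x : ℝ} (hx : 0 < x) (hGx : ContinuousAt G x) :
    Tendsto (fun i => F i x) L (𝓝 (G x)) := by
  have hconv : ∀ p q, Tendsto (fun i => ∫ u in Ioi 0, tent p q u * F i u) L
      (𝓝 (∫ u in Ioi 0, tent p q u * G u)) := fun p q =>
    tendsto_integral_mul_of_tendsto_laplace hF0 hG0 hF hG hlap (continuous_tent p q) (M := q)
      fun u hu => tent_eq_zero fun h => absurd h.2 (not_lt.2 hu)
  have hint : ∀ p q, 0 < p → IntegrableOn (tent p q) (Ioi 0) := fun p q hp =>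
    ((continuous_tent p q).integrable_of_hasCompactSupport <|
      HasCompactSupport.intro (isCompact_Icc (a := p) (b := q)) fun u hu =>
        tent_eq_zero fun h => hu ⟨h.1.le, h.2.le⟩).integrableOn
  have hintA : ∀ p q, 0 < p → ∀ A : ℝ → ℝ,
      IntegrableOn (fun u => Real.exp (-u) * A u) (Ioi 0) →
      IntegrableOn (fun u => tent p q u * A u) (Ioi 0) := by
    intro p q hp A hA
    have hc : Continuous fun u => tent p q u * Real.exp u := by
      have := continuous_tent p q
      fun_prop
    obtain ⟨C, hC⟩ := hc.bounded_above_of_compact_support <|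
      HasCompactSupport.intro (isCompact_Icc (a := p) (b := q)) fun u hu => by
        rw [tent_eq_zero fun h => hu ⟨h.1.le, h.2.le⟩, zero_mul]
    refine (Integrable.bdd_mul (c := C) hA hc.aestronglyMeasurable
      (ae_of_all _ hC)).congr (ae_of_all _ fun u => ?_)
    simp only
    rw [mul_assoc, ← mul_assoc (Real.exp u), ← Real.exp_add]
    simp
  have hupper : ∀ p q, 0 < p → ∀ A : ℝ → ℝ, AntitoneOn A (Ioi 0) →
      IntegrableOn (fun u => Real.exp (-u) * A u) (Ioi 0) →
      ∫ u in Ioi 0, tent p q u * A u ≤ (∫ u in Ioi 0, tent p q u) * A p := by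
    intro p q hp A hA hAi
    rw [← integral_mul_const]
    refine integral_mono (hintA p q hp A hAi) ((hint p q hp).mul_const _) fun u => ?_
    by_cases hu : u ∈ Ioo p q
    · exact mul_le_mul_of_nonneg_left (hA hp (hp.trans hu.1) hu.1.le) (tent_nonneg _ _ _)
    · simp [tent_eq_zero hu]
  have hlower : ∀ p q, 0 < p → 0 < q → ∀ A : ℝ → ℝ, AntitoneOn A (Ioi 0) →
      IntegrableOn (fun u => Real.exp (-u) * A u) (Ioi 0) →
      (∫ u in Ioi 0, tent p q u) * A q ≤ ∫ u in Ioi 0, tent p q u * A u := by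
    intro p q hp hq A hA hAi
    rw [← integral_mul_const]
    refine integral_mono ((hint p q hp).mul_const _) (hintA p q hp A hAi) fun u => ?_
    by_cases hu : u ∈ Ioo p q
    · exact mul_le_mul_of_nonneg_left (hA (hp.trans hu.1) hq hu.2.le) (tent_nonneg _ _ _)
    · simp [tent_eq_zero hu]
  -- By monotonicity `F i x` is at least its tent average over `[x, q]` and at most that over `[p,
  -- x]`. These averages converge to those of `G`, which continuity at `x` keeps on the right side
  -- of `a`.
  refine tendsto_order.2 ⟨fun a ha => ?_, fun a ha => ?_⟩
  · obtain ⟨q, hq, hxq⟩ := (((hGx.eventually (lt_mem_nhds ha)).filter_mono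
      nhdsWithin_le_nhds).and (self_mem_nhdsWithin (s := Ioi x))).exists
    have hT := integral_tent_pos hx hxq
    have h1 : (∫ u in Ioi 0, tent x q u) * a < ∫ u in Ioi 0, tent x q u * G u :=
      (mul_lt_mul_of_pos_left hq hT).trans_le (hlower x q hx (hx.trans hxq) G hGa hG)
    filter_upwards [(hconv x q).eventually (lt_mem_nhds h1)] with i hi
    exact lt_of_mul_lt_mul_left (hi.trans_le (hupper x q hx _ (hFa i) (hF i))) hT.le
  · obtain ⟨p, ⟨hp, hp0⟩, hxp⟩ := ((((hGx.eventually (gt_mem_nhds ha)).and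
      (lt_mem_nhds hx)).filter_mono nhdsWithin_le_nhds).and
      (self_mem_nhdsWithin (s := Iio x))).exists
    have hT := integral_tent_pos hp0 hxp
    have h1 : ∫ u in Ioi 0, tent p x u * G u < (∫ u in Ioi 0, tent p x u) * a :=
      (hupper p x hp0 G hGa hG).trans_lt (mul_lt_mul_of_pos_left hp hT)
    filter_upwards [(hconv p x).eventually (gt_mem_nhds h1)] with i hi
    exact lt_of_mul_lt_mul_left ((hlower p x hp0 hx _ (hFa i) (hF i)).trans_lt hi) hT.le

end Tauberian

/-! ### Taylor series of Bernstein functions -/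

section Taylor

/-- The absolute values of the Taylor coefficients of order `k + 1` of a Bernstein function. -/
noncomputable def bernsteinCoeff (ψ : ℝ → ℝ) (y : ℝ) (k : ℕ) : ℝ :=
  (-1) ^ k * iteratedDeriv (k + 1) ψ y / (k + 1).factorial

theorem IsBernstein.bernsteinCoeff_nonneg {ψ : ℝ → ℝ} (hψ : IsBernstein ψ) {y : ℝ} (hy : 0 < y)
    (k : ℕ) : 0 ≤ bernsteinCoeff ψ y k := by
  have := hψ.sign (k + 1) (by omega) y hy
  rw [pow_succ] at this
  exact div_nonneg (by linarith) (by positivity)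

theorem IsBernstein.iteratedDerivWithin_eq {ψ : ℝ → ℝ} (hψ : IsBernstein ψ) {x y t : ℝ}
    (hx : 0 < x) (hxy : x < y) (ht : t ∈ uIcc y x) (n : ℕ) :
    iteratedDerivWithin n ψ (uIcc y x) t = iteratedDeriv n ψ t := by
  have ht0 : 0 < t := by
    rw [uIcc_of_ge hxy.le] at ht
    exact hx.trans_le ht.1
  refine iteratedDerivWithin_eq_iteratedDeriv (uniqueDiffOn_uIcc hxy.ne') ?_ ht
  exact ((hψ.contDiffOn.contDiffAt (Ioi_mem_nhds ht0)).of_le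
    (by exact_mod_cast le_top))

/-- Expanding at the right endpoint makes the alternating signs of the derivatives cancel against
those of `(x - y) ^ (k + 1)`: all terms and the remainder are non-negative. -/
theorem IsBernstein.taylor {ψ : ℝ → ℝ} (hψ : IsBernstein ψ) {x y : ℝ} (hx : 0 < x) (hxy : x < y)
    (n : ℕ) :
    ψ y - ψ x = ∑ k ∈ Finset.range n, bernsteinCoeff ψ y k * (y - x) ^ (k + 1) +
      ∫ t in x..y, (t - x) ^ n / n.factorial * ((-1) ^ n * iteratedDeriv (n + 1) ψ t) := by
  have hsub : uIcc y x ⊆ Ioi 0 := by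
    rw [uIcc_of_ge hxy.le]
    exact fun t ht => hx.trans_le ht.1
  have h := taylor_integral_remainder (f := ψ) (x := x) (x₀ := y) (n := n)
    ((hψ.contDiffOn.mono hsub).of_le (by exact_mod_cast le_top))
  have h2 : ∫ t in y..x, ((x - t) ^ n / n.factorial) • iteratedDerivWithin (n + 1) ψ (uIcc y x) t
      = - ∫ t in x..y, (t - x) ^ n / n.factorial * ((-1) ^ n * iteratedDeriv (n + 1) ψ t) := by
    rw [intervalIntegral.integral_symm]
    congr 1
    refine intervalIntegral.integral_congr fun t ht => ?_
    rw [uIcc_comm] at ht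
    simp only [smul_eq_mul]
    rw [hψ.iteratedDerivWithin_eq hx hxy ht, ← neg_sub t x, neg_pow]
    ring
  rw [h2, taylor_within_apply, Finset.sum_range_succ'] at h
  have h3 : ∀ k, ((k + 1).factorial : ℝ)⁻¹ * (x - y) ^ (k + 1) •
      iteratedDerivWithin (k + 1) ψ (uIcc y x) y =
      - (bernsteinCoeff ψ y k * (y - x) ^ (k + 1)) := by
    intro k
    rw [hψ.iteratedDerivWithin_eq hx hxy left_mem_uIcc, ← neg_sub y x, neg_pow, bernsteinCoeff,
      smul_eq_mul]
    ring
  simp only [smul_eq_mul, mul_assoc] at h h3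
  simp only [h3, Finset.sum_neg_distrib] at h
  simp at h
  linarith

theorem IsBernstein.remainder_nonneg {ψ : ℝ → ℝ} (hψ : IsBernstein ψ) {t : ℝ} (ht : 0 < t)
    (n : ℕ) : 0 ≤ (-1) ^ n * iteratedDeriv (n + 1) ψ t := by
  have := hψ.sign (n + 1) (by omega) t ht
  rw [pow_succ] at this
  linarith

theorem IsBernstein.intervalIntegrable_remainder {ψ : ℝ → ℝ} (hψ : IsBernstein ψ) {a x y : ℝ}
    (hx : 0 < x) (hxy : x < y) (n : ℕ) :
    IntervalIntegrable
      (fun t => (t - a) ^ n / n.factorial * ((-1) ^ n * iteratedDeriv (n + 1) ψ t)) volume x y := by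
  have hsub : uIcc y x ⊆ Ioi 0 := by
    rw [uIcc_of_ge hxy.le]
    exact fun t ht => hx.trans_le ht.1
  have h1 : ContinuousOn (iteratedDerivWithin (n + 1) ψ (uIcc y x)) (uIcc y x) :=
    (hψ.contDiffOn.mono hsub).continuousOn_iteratedDerivWithin (by exact_mod_cast le_top)
      (uniqueDiffOn_uIcc hxy.ne')
  have h2 : ContinuousOn (iteratedDeriv (n + 1) ψ) (uIcc x y) := by
    rw [uIcc_comm]
    exact h1.congr fun t ht => (hψ.iteratedDerivWithin_eq hx hxy ht _).symm
  exact ContinuousOn.intervalIntegrable (by fun_prop)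

theorem IsBernstein.sum_le {ψ : ℝ → ℝ} (hψ : IsBernstein ψ) {x y : ℝ} (hx : 0 < x) (hxy : x < y)
    (n : ℕ) :
    ∑ k ∈ Finset.range n, bernsteinCoeff ψ y k * (y - x) ^ (k + 1) ≤ ψ y := by
  have h := hψ.taylor hx hxy n
  have h1 : 0 ≤ ∫ t in x..y, (t - x) ^ n / n.factorial * ((-1) ^ n * iteratedDeriv (n + 1) ψ t) :=
    intervalIntegral.integral_nonneg hxy.le fun t ht =>
      mul_nonneg (div_nonneg (pow_nonneg (by linarith [ht.1]) _) (by positivity))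
        (hψ.remainder_nonneg (hx.trans_le ht.1) n)
  linarith [hψ.nonneg x hx.le]

/-- The Taylor series of a Bernstein function at `y` converges to it on `(0, y)`. -/
theorem IsBernstein.hasSum_taylor {ψ : ℝ → ℝ} (hψ : IsBernstein ψ) {x y : ℝ} (hx : 0 < x)
    (hxy : x < y) :
    HasSum (fun k => bernsteinCoeff ψ y k * (y - x) ^ (k + 1)) (ψ y - ψ x) := by
  have hy : 0 < y := hx.trans hxy
  rw [hasSum_iff_tendsto_nat_of_nonneg fun k => mul_nonneg (hψ.bernsteinCoeff_nonneg hy k)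
    (pow_nonneg (by linarith) _)]
  -- On `[x, y]` the quotient `(t - x) / (t - x / 2)` is largest at `t = y`, where it equals `θ <
  -- 1`. So the remainder for `x` is at most `θ ^ n` times that for `x / 2`, which is bounded by `ψ
  -- y`.
  set θ : ℝ := (y - x) / (y - x / 2) with hθ
  have hd : 0 < y - x / 2 := by linarith
  have hθ0 : 0 ≤ θ := div_nonneg (by linarith) hd.le
  have hθ1 : θ < 1 := by
    rw [hθ, div_lt_one hd]; linarith
  have hup : ∀ n : ℕ, ∫ t in x..y, (t - x) ^ n / n.factorial *
      ((-1) ^ n * iteratedDeriv (n + 1) ψ t) ≤ θ ^ n * ψ y := by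
    intro n
    have hx2 : 0 < x / 2 := by linarith
    have hx2y : x / 2 < y := by linarith
    have h1 : ∫ t in x..y, (t - x) ^ n / n.factorial * ((-1) ^ n * iteratedDeriv (n + 1) ψ t) ≤
        ∫ t in x..y, θ ^ n * ((t - x / 2) ^ n / n.factorial *
          ((-1) ^ n * iteratedDeriv (n + 1) ψ t)) := by
      refine intervalIntegral.integral_mono_on hxy.le (hψ.intervalIntegrable_remainder hx hxy n)
        ((hψ.intervalIntegrable_remainder hx hxy n).const_mul _) fun t ht => ?_
      have h2 : t - x ≤ θ * (t - x / 2) := by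
        rw [hθ, div_mul_eq_mul_div, le_div_iff₀ hd]
        nlinarith [ht.1, ht.2]
      have h3 : (t - x) ^ n ≤ θ ^ n * (t - x / 2) ^ n := by
        rw [← mul_pow]
        exact pow_le_pow_left₀ (by linarith [ht.1]) h2 n
      rw [← mul_assoc (θ ^ n)]
      refine mul_le_mul_of_nonneg_right ?_ (hψ.remainder_nonneg (hx.trans_le ht.1) n)
      rw [← mul_div_assoc]
      gcongr
    refine h1.trans ?_
    rw [intervalIntegral.integral_const_mul]
    refine mul_le_mul_of_nonneg_left ?_ (pow_nonneg hθ0 n)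
    have h4 := hψ.taylor hx2 hx2y n
    have h5 : 0 ≤ ∑ k ∈ Finset.range n, bernsteinCoeff ψ y k * (y - x / 2) ^ (k + 1) :=
      Finset.sum_nonneg fun k _ => mul_nonneg (hψ.bernsteinCoeff_nonneg hy k)
        (pow_nonneg (by linarith) _)
    have h6 : ∫ t in x..y, (t - x / 2) ^ n / n.factorial *
        ((-1) ^ n * iteratedDeriv (n + 1) ψ t) ≤
        ∫ t in (x / 2)..y, (t - x / 2) ^ n / n.factorial *
        ((-1) ^ n * iteratedDeriv (n + 1) ψ t) := by
      refine intervalIntegral.integral_mono_interval (by linarith) hxy.le le_rfl ?_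
        (hψ.intervalIntegrable_remainder hx2 hx2y n)
      filter_upwards [ae_restrict_mem measurableSet_Ioc] with t ht
      exact mul_nonneg (div_nonneg (pow_nonneg (by linarith [ht.1]) _) (by positivity))
        (hψ.remainder_nonneg (hx2.trans ht.1) n)
    linarith [hψ.nonneg (x / 2) hx2.le]
  have hlow : ∀ n : ℕ, 0 ≤ ∫ t in x..y, (t - x) ^ n / n.factorial *
      ((-1) ^ n * iteratedDeriv (n + 1) ψ t) := fun n =>
    intervalIntegral.integral_nonneg hxy.le fun t ht =>
      mul_nonneg (div_nonneg (pow_nonneg (by linarith [ht.1]) _) (by positivity))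
        (hψ.remainder_nonneg (hx.trans_le ht.1) n)
  have hlim : Tendsto (fun n : ℕ => θ ^ n * ψ y) atTop (𝓝 0) := by
    simpa using (tendsto_pow_atTop_nhds_zero_of_lt_one hθ0 hθ1).mul_const (ψ y)
  have hrem := squeeze_zero hlow hup hlim
  have := hrem.const_sub (ψ y - ψ x)
  rw [sub_zero] at this
  refine this.congr fun n => ?_
  rw [hψ.taylor hx hxy n]
  ring

/-- Let `x` decrease to `0` in `IsBernstein.sum_le`. An inequality suffices: the gap will become an
atom. -/
theorem IsBernstein.summable_bernsteinCoeff {ψ : ℝ → ℝ} (hψ : IsBernstein ψ) {y : ℝ}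
    (hy : 0 < y) : Summable (fun k => bernsteinCoeff ψ y k * y ^ (k + 1)) ∧
      ∑' k, bernsteinCoeff ψ y k * y ^ (k + 1) ≤ ψ y := by
  have hb : ∀ n, ∑ k ∈ Finset.range n, bernsteinCoeff ψ y k * y ^ (k + 1) ≤ ψ y := by
    intro n
    have hc : Tendsto (fun x : ℝ => ∑ k ∈ Finset.range n, bernsteinCoeff ψ y k * (y - x) ^ (k + 1))
        (𝓝[>] 0) (𝓝 (∑ k ∈ Finset.range n, bernsteinCoeff ψ y k * (y - 0) ^ (k + 1))) := by
      refine Tendsto.mono_left (Continuous.tendsto ?_ 0) nhdsWithin_le_nhds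
      fun_prop
    rw [sub_zero] at hc
    refine le_of_tendsto hc ?_
    filter_upwards [Ioo_mem_nhdsGT hy] with x hx using hψ.sum_le hx.1 hx.2 n
  have h0 : ∀ k, 0 ≤ bernsteinCoeff ψ y k * y ^ (k + 1) := fun k =>
    mul_nonneg (hψ.bernsteinCoeff_nonneg hy k) (by positivity)
  exact ⟨summable_of_sum_range_le h0 hb, Real.tsum_le_of_sum_range_le h0 hb⟩

end Taylor

/-! ### Bernstein functions as mixtures of power slopes -/

section LevyKhintchine

/-- The continuous extension to `w = 1` of `(1 - w ^ x) / (1 - w)`. -/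
noncomputable def powerSlope (x : ℝ) : ℝ → ℝ := dslope (fun w : ℝ => w ^ x) 1

theorem powerSlope_one {x : ℝ} : powerSlope x 1 = x := by
  simp [powerSlope, dslope_same]

theorem powerSlope_of_ne {x w : ℝ} (hw : w ≠ 1) : powerSlope x w = (1 - w ^ x) / (1 - w) := by
  rw [powerSlope, dslope_of_ne _ hw, slope_def_field, Real.one_rpow, ← neg_sub, ← neg_sub 1 w,
    neg_div_neg_eq]

theorem powerSlope_zero {x : ℝ} (hx : 0 < x) : powerSlope x 0 = 1 := by
  rw [powerSlope_of_ne zero_ne_one, Real.zero_rpow hx.ne']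
  norm_num

theorem powerSlope_nonneg {x w : ℝ} (hx : 0 < x) (hw0 : 0 ≤ w) (hw1 : w ≤ 1) :
    0 ≤ powerSlope x w := by
  rcases hw1.eq_or_lt with rfl | h
  · rw [powerSlope_one]; exact hx.le
  · rw [powerSlope_of_ne h.ne]
    exact div_nonneg (by linarith [Real.rpow_le_one hw0 hw1 hx.le]) (by linarith)

theorem continuous_powerSlope {x : ℝ} (hx : 0 < x) : Continuous (powerSlope x) := by
  rw [continuous_iff_continuousAt]
  intro w
  by_cases hw : w = 1
  · subst hw
    exact continuousAt_dslope_same.2 (Real.differentiableAt_rpow_const_of_ne x one_ne_zero)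
  · exact (continuousAt_dslope_of_ne hw).2 (Real.continuousAt_rpow_const w x (Or.inr hx.le))

theorem powerSlope_exp {x u : ℝ} (hu : u ≠ 0) :
    powerSlope x (Real.exp (-u)) = (1 - Real.exp (-(x * u))) / (1 - Real.exp (-u)) := by
  rw [powerSlope_of_ne (by simpa using hu), ← Real.exp_mul]
  ring_nf

/-- The power slope as a continuous function on the unit interval. -/
noncomputable def powerSlopeMap (x : ℝ) (hx : 0 < x) : C(unitInterval, ℝ) :=
  ⟨fun w => powerSlope x w, (continuous_powerSlope hx).comp continuous_subtype_val⟩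

open unitInterval in
/-- The functions `x ↦ ψ (y (1 - exp (-x / y)))` have a Lévy representation with a discrete
measure. -/
theorem IsBernstein.exists_discrete_measure {ψ : ℝ → ℝ} (hψ : IsBernstein ψ) {y : ℝ}
    (hy : 0 < y) : ∃ κ : FiniteMeasure I, ∀ x : ℝ, 0 < x →
      ∫ w : I, powerSlope x w ∂(κ : Measure I) = ψ (y * (1 - Real.exp (-(x / y)))) := by
  obtain ⟨hS, hSle⟩ := hψ.summable_bernsteinCoeff hy
  set S := ∑' k, bernsteinCoeff ψ y k * y ^ (k + 1) with hSdef
  have hu : ∀ k : ℕ, 0 < ((k + 1 : ℕ) : ℝ) / y := fun k => by positivity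
  -- The last factor cancels the denominator of `powerSlope x` at `exp (-(k + 1) / y)`. The
  -- numerator `1 - exp (-x (k + 1) / y)` then gives the difference of the Taylor terms at distances
  -- `y` and `y * exp (-x / y)` from `y`.
  set m : ℕ → ℝ := fun k =>
    bernsteinCoeff ψ y k * y ^ (k + 1) * (1 - Real.exp (-(((k + 1 : ℕ) : ℝ) / y))) with hm
  have he : ∀ k : ℕ, Real.exp (-(((k + 1 : ℕ) : ℝ) / y)) < 1 := fun k =>
    Real.exp_lt_one_iff.2 (by linarith [hu k])
  have hc : ∀ k, 0 ≤ bernsteinCoeff ψ y k * y ^ (k + 1) := fun k =>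
    mul_nonneg (hψ.bernsteinCoeff_nonneg hy k) (by positivity)
  have hm0 : ∀ k, 0 ≤ m k := fun k => mul_nonneg (hc k) (by linarith [he k])
  have hms : Summable m := by
    refine Summable.of_nonneg_of_le hm0 (fun k => ?_) hS
    exact mul_le_of_le_one_right (hc k) (by linarith [Real.exp_pos (-(((k + 1 : ℕ) : ℝ) / y))])
  set p : ℕ → I := fun k => ⟨Real.exp (-(((k + 1 : ℕ) : ℝ) / y)), (Real.exp_pos _).le, (he k).le⟩
    with hp
  set κs : ℕ → Measure I := fun k => ENNReal.ofReal (m k) • Measure.dirac (p k) with hκs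
  -- Since `powerSlope x 0 = 1`, the atom at `0` supplies the missing constant `ψ y - S`.
  set κ : Measure I := ENNReal.ofReal (ψ y - S) • Measure.dirac 0 + Measure.sum κs with hκ
  have hfin : IsFiniteMeasure (Measure.sum κs) := by
    constructor
    rw [Measure.sum_apply _ MeasurableSet.univ]
    simp only [hκs, Measure.smul_apply, measure_univ, smul_eq_mul, mul_one]
    rw [← ENNReal.ofReal_tsum_of_nonneg hm0 hms]
    exact ENNReal.ofReal_lt_top
  have hfin0 : IsFiniteMeasure (ENNReal.ofReal (ψ y - S) • Measure.dirac (0 : I)) := by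
    constructor
    simp
  have hfin' : IsFiniteMeasure κ := by
    rw [hκ]; infer_instance
  refine ⟨⟨κ, hfin'⟩, fun x hx => ?_⟩
  rw [FiniteMeasure.toMeasure_mk]
  have hint : ∀ μ : Measure I, IsFiniteMeasure μ → Integrable (fun w : I => powerSlope x w) μ :=
    fun μ _ => (powerSlopeMap x hx).continuous.integrable_of_hasCompactSupport
      (HasCompactSupport.of_compactSpace _)
  rw [hκ, integral_add_measure (hint _ hfin0) (hint _ hfin)]
  have h1 := hasSum_integral_measure (hint _ hfin)
  have h2 : ∀ k, ∫ w : I, powerSlope x w ∂(κs k) =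
      bernsteinCoeff ψ y k * y ^ (k + 1) -
        bernsteinCoeff ψ y k * (y - y * (1 - Real.exp (-(x / y)))) ^ (k + 1) := by
    intro k
    simp only [hκs, integral_smul_measure, integral_dirac, ENNReal.toReal_ofReal (hm0 k), hp,
      smul_eq_mul]
    rw [powerSlope_exp (hu k).ne', hm]
    simp only
    have h3 : 1 - Real.exp (-(((k + 1 : ℕ) : ℝ) / y)) ≠ 0 := by linarith [he k]
    have h4 : Real.exp (-(x * (((k + 1 : ℕ) : ℝ) / y))) = Real.exp (-(x / y)) ^ (k + 1) := by
      rw [← Real.exp_nat_mul]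
      ring_nf
    rw [h4, mul_assoc, mul_div_cancel₀ _ h3,
      show y - y * (1 - Real.exp (-(x / y))) = y * Real.exp (-(x / y)) by ring, mul_pow]
    ring
  simp only [h2] at h1
  have hex : Real.exp (-(x / y)) < 1 := Real.exp_lt_one_iff.2 (by linarith [div_pos hx hy])
  have h3 := hψ.hasSum_taylor (y := y) (x := y * (1 - Real.exp (-(x / y))))
    (mul_pos hy (by linarith)) (mul_lt_of_lt_one_right hy (by linarith [Real.exp_pos (-(x / y))]))
  have h4 := h1.unique (hS.hasSum.sub h3)
  rw [h4, ← hSdef, integral_smul_measure, integral_dirac, ENNReal.toReal_ofReal (by linarith)]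
  simp only [Set.Icc.coe_zero, powerSlope_zero hx, smul_eq_mul]
  ring

theorem tendsto_mul_one_sub_exp (x : ℝ) :
    Tendsto (fun y : ℝ => y * (1 - Real.exp (-(x / y)))) atTop (𝓝 x) := by
  have h1 : HasDerivAt (fun s : ℝ => 1 - Real.exp (-(x * s))) x 0 := by
    have := ((((hasDerivAt_id (0 : ℝ)).const_mul x).neg).exp).const_sub 1
    simpa using this
  have h2 := h1.tendsto_slope_zero_right
  simp only [zero_add, mul_zero, neg_zero, Real.exp_zero, sub_self, sub_zero, smul_eq_mul] at h2
  refine (h2.comp tendsto_inv_atTop_nhdsGT_zero).congr fun y => ?_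
  simp [div_eq_mul_inv]

open unitInterval in
/-- A Bernstein function is a mixture of power slopes on `(0, ∞)`. -/
theorem IsBernstein.exists_measure {ψ : ℝ → ℝ} (hψ : IsBernstein ψ) :
    ∃ κ : FiniteMeasure I, ∀ x : ℝ, 0 < x → ∫ w : I, powerSlope x w ∂(κ : Measure I) = ψ x := by
  have hex : ∀ y : ℝ, ∃ κ : FiniteMeasure I, 0 < y → ∀ x : ℝ, 0 < x →
      ∫ w : I, powerSlope x w ∂(κ : Measure I) = ψ (y * (1 - Real.exp (-(x / y)))) := by
    intro y
    by_cases hy : 0 < y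
    · obtain ⟨κ, hκ⟩ := hψ.exists_discrete_measure hy
      exact ⟨κ, fun _ => hκ⟩
    · exact ⟨0, fun h => absurd h hy⟩
  choose κ hκ using hex
  have hlim : ∀ x : ℝ, 0 < x →
      Tendsto (fun y => ∫ w : I, powerSlope x w ∂(κ y : Measure I)) atTop (𝓝 (ψ x)) := by
    intro x hx
    have h1 := ((hψ.continuousOn.continuousAt (Ici_mem_nhds hx)).tendsto).comp
      (tendsto_mul_one_sub_exp x)
    refine h1.congr' ?_
    filter_upwards [eventually_gt_atTop 0] with y hy
    rw [hκ y hy x hx]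
    rfl
  have hmass : ∀ᶠ y in atTop, κ y ∈
      {μ : FiniteMeasure I | μ.mass ≤ (ψ 1 + 1).toNNReal} := by
    filter_upwards [(hlim 1 one_pos).eventually_le_const (show ψ 1 < ψ 1 + 1 by linarith)]
      with y hy
    -- Hence the total mass of `κ y` is the integral at `x = 1`, which tends to `ψ 1`.
    have h1 : ∀ w : I, powerSlope 1 w = 1 := by
      intro w
      by_cases hw : (w : ℝ) = 1
      · rw [hw, powerSlope_one]
      · rw [powerSlope_of_ne hw, Real.rpow_one, div_self (sub_ne_zero.2 (Ne.symm hw))]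
    simp only [h1, integral_const, smul_eq_mul, mul_one] at hy
    refine NNReal.le_toNNReal_of_coe_le ?_
    exact hy
  -- An ultrafilter finer than `atTop` takes the place of a convergent subsequence.
  set U := Ultrafilter.of (atTop : Filter ℝ)
  have hU : (U : Filter ℝ) ≤ atTop := Ultrafilter.of_le _
  obtain ⟨μ, -, hμ⟩ := (isCompact_setOfPred_finiteMeasure_le_of_compactSpace I
    (ψ 1 + 1).toNNReal).ultrafilter_le_nhds' (U.map κ) (hU hmass)
  have hμ' : Tendsto κ U (𝓝 μ) := hμ
  refine ⟨μ, fun x hx => ?_⟩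
  have h1 := FiniteMeasure.tendsto_iff_forall_integral_tendsto.1 hμ'
    (BoundedContinuousFunction.mkOfCompact (powerSlopeMap x hx))
  exact tendsto_nhds_unique h1 ((hlim x hx).mono_left hU)

end LevyKhintchine

/-! ### From the mixture to a Lévy triple -/

section LevyTriple

/-- This bounds `min 1 s / (1 - w)` for `w = exp (-s)`, so that `min 1 s` is integrable for the
measure obtained from the finite `κ`. -/
theorem min_one_le_two_mul_one_sub_exp {u : ℝ} (hu : 0 ≤ u) :
    min 1 u ≤ 2 * (1 - Real.exp (-u)) := by
  have h1 : Real.exp (-u) ≤ 1 / (1 + u) := by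
    rw [Real.exp_neg, ← one_div]
    exact one_div_le_one_div_of_le (by linarith) (by linarith [Real.add_one_le_exp u])
  have h2 : u / (1 + u) = 1 - 1 / (1 + u) := by field_simp; ring
  have h3 : min 1 u ≤ 2 * (u / (1 + u)) := by
    rw [← mul_div_assoc, le_div_iff₀ (by linarith)]
    rcases le_total 1 u with h | h
    · rw [min_eq_left h]; linarith
    · rw [min_eq_right h]; nlinarith
  linarith

theorem one_sub_exp_le_mul_min {x s : ℝ} (hs : 0 ≤ s) :
    1 - Real.exp (-(x * s)) ≤ max 1 x * min 1 s := by
  have h1 := Real.add_one_le_exp (-(x * s))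
  have h2 := Real.exp_pos (-(x * s))
  rcases le_total 1 s with h | h
  · rw [min_eq_left h]; linarith [le_max_left 1 x]
  · rw [min_eq_right h]
    nlinarith [le_max_right 1 x]

theorem exp_neg_mul_le_one {x s : ℝ} (hx : 0 ≤ x) (hs : 0 ≤ s) : Real.exp (-(x * s)) ≤ 1 :=
  Real.exp_le_one_iff.2 (by nlinarith [mul_nonneg hx hs])

open unitInterval in
theorem IsBernstein.exists_isLevyTriple {ψ : ℝ → ℝ} (hψ : IsBernstein ψ) (hψ0 : ψ 0 = 0) :
    ∃ (a b : ℝ) (ν : Measure ℝ≥0), IsLevyTriple ψ a b ν := by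
  obtain ⟨κ, hκ⟩ := hψ.exists_measure
  have hint : ∀ x : ℝ, 0 < x → Integrable (fun w : I => powerSlope x w) (κ : Measure I) :=
    fun x hx => (powerSlopeMap x hx).continuous.integrable_of_hasCompactSupport
      (HasCompactSupport.of_compactSpace _)
  -- An atom at `w = 0`, that is `s = ∞`, would make `ψ` jump at `0`. Excluding it also disposes of
  -- the default value `Real.log 0 = 0` in `φ`.
  have hzero : (κ : Measure I) {0} = 0 := by
    have h1 : ∀ x : ℝ, 0 < x → (κ : Measure I).real {0} ≤ ψ x := by
      intro x hx
      have h2 : ∫ w : I in {0}, powerSlope x w ∂(κ : Measure I) = (κ : Measure I).real {0} := by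
        rw [integral_singleton, Set.Icc.coe_zero, powerSlope_zero hx, smul_eq_mul, mul_one]
      rw [← hκ x hx, ← h2]
      exact setIntegral_le_integral (hint x hx)
        (ae_of_all _ fun w => powerSlope_nonneg hx w.2.1 w.2.2)
    have h3 : Tendsto ψ (𝓝[>] 0) (𝓝 0) := by
      have := (hψ.continuousOn 0 self_mem_Ici).mono Ioi_subset_Ici_self
      rwa [ContinuousWithinAt, hψ0] at this
    have h4 : (κ : Measure I).real {0} ≤ 0 := by
      refine ge_of_tendsto h3 ?_
      filter_upwards [self_mem_nhdsWithin] with x hx using h1 x hx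
    have h5 := le_antisymm h4 measureReal_nonneg
    rwa [measureReal_eq_zero_iff] at h5
  set A : Set I := {1}ᶜ
  have hA : MeasurableSet A := (measurableSet_singleton _).compl
  set φ : I → ℝ≥0 := fun w => (-Real.log w).toNNReal with hφ
  have hφm : Measurable φ :=
    (Real.measurable_log.comp measurable_subtype_coe).neg.real_toNNReal
  have hφc : ∀ w : I, ((φ w : ℝ≥0) : ℝ) = -Real.log w := fun w =>
    Real.coe_toNNReal _ (neg_nonneg.2 (Real.log_nonpos w.2.1 w.2.2))
  set d : I → ENNReal := fun w => ENNReal.ofReal (1 - (w : ℝ))⁻¹ with hd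
  have hdm : Measurable d := by
    refine ENNReal.measurable_ofReal.comp ?_
    exact (measurable_const.sub measurable_subtype_coe).inv
  have hdc : ∀ w : I, (d w).toReal = (1 - (w : ℝ))⁻¹ := fun w =>
    ENNReal.toReal_ofReal (inv_nonneg.2 (sub_nonneg.2 w.2.2))
  have hdt : ∀ᵐ w ∂((κ : Measure I).restrict A), d w < ⊤ :=
    ae_of_all _ fun w => ENNReal.ofReal_lt_top
  set ν : Measure ℝ≥0 := (((κ : Measure I).restrict A).withDensity d).map φ with hν
  have hAe : ∀ᵐ w : I ∂((κ : Measure I).restrict A), (w : ℝ) ≠ 1 ∧ (w : ℝ) ≠ 0 := by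
    rw [ae_restrict_iff' hA]
    have : ∀ᵐ w ∂(κ : Measure I), w ≠ 0 := by
      rw [ae_iff]
      simpa using hzero
    filter_upwards [this] with w hw hwA
    refine ⟨fun h => hwA (Subtype.ext h), fun h => hw (Subtype.ext h)⟩
  have hpos : ∀ w : I, (w : ℝ) ≠ 0 → Real.exp (-(φ w : ℝ)) = w := by
    intro w hw
    rw [hφc, neg_neg, Real.exp_log (lt_of_le_of_ne w.2.1 (Ne.symm hw))]
  refine ⟨0, (κ : Measure I).real {1}, ν, le_rfl, measureReal_nonneg, ?_, ?_⟩
  · have hm : Measurable fun s : ℝ≥0 => min 1 (s : ℝ) := by fun_prop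
    rw [hν, integrable_map_measure hm.aestronglyMeasurable hφm.aemeasurable,
      integrable_withDensity_iff_integrable_smul' hdm hdt]
    refine Integrable.of_bound (C := 2) ?_ ?_
    · exact (hdm.ennreal_toReal.smul (hm.comp hφm)).aestronglyMeasurable
    · filter_upwards [hAe] with w hw
      have h1 : (0 : ℝ) < 1 - w := by
        have := lt_of_le_of_ne w.2.2 hw.1
        linarith
      rw [hdc, smul_eq_mul, Function.comp_apply, Real.norm_of_nonneg (by positivity)]
      have h2 := min_one_le_two_mul_one_sub_exp (φ w).2
      rw [NNReal.val_eq_coe, hpos w hw.2] at h2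
      rw [inv_mul_le_iff₀ h1]
      linarith
  · intro x hx
    rcases hx.eq_or_lt with rfl | hx
    · simp [hψ0]
    have hm : Measurable fun s : ℝ≥0 => 1 - Real.exp (-(x * (s : ℝ))) := by fun_prop
    rw [hν, integral_map hφm.aemeasurable hm.aestronglyMeasurable,
      integral_withDensity_eq_integral_toReal_smul hdm hdt, ← hκ x hx,
      ← integral_add_compl hA (hint x hx), compl_compl, integral_singleton,
      Set.Icc.coe_one, powerSlope_one, smul_eq_mul, zero_add, add_comm]
    congr 1
    refine integral_congr_ae ?_
    filter_upwards [hAe] with w hw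
    rw [hdc, powerSlope_of_ne hw.1, smul_eq_mul, div_eq_inv_mul]
    congr 2
    rw [mul_comm x, ← neg_mul, Real.exp_mul, hpos w hw.2]

end LevyTriple

/-! ### Monotonicity, concavity and the generating function -/

section TripleProperties

variable {ψ : ℝ → ℝ} {a b : ℝ} {ν : Measure ℝ≥0}

theorem IsLevyTriple.integrable_one_sub_exp (h : IsLevyTriple ψ a b ν) {x : ℝ} (hx : 0 ≤ x) :
    Integrable (fun s : ℝ≥0 => 1 - Real.exp (-(x * s))) ν := by
  refine (h.integrable.const_mul (max 1 x)).mono' (by fun_prop) (ae_of_all _ fun s => ?_)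
  rw [Real.norm_of_nonneg (sub_nonneg.2 (exp_neg_mul_le_one hx s.coe_nonneg))]
  exact one_sub_exp_le_mul_min s.2

theorem IsLevyTriple.mono (h : IsLevyTriple ψ a b ν) {x y : ℝ} (hx : 0 ≤ x) (hxy : x ≤ y) :
    ψ x ≤ ψ y := by
  rw [h.eq x hx, h.eq y (hx.trans hxy)]
  have h1 := mul_le_mul_of_nonneg_left hxy h.b_nonneg
  have h2 : ∫ s : ℝ≥0, (1 - Real.exp (-(x * s))) ∂ν ≤ ∫ s : ℝ≥0, (1 - Real.exp (-(y * s))) ∂ν := by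
    refine integral_mono (h.integrable_one_sub_exp hx) (h.integrable_one_sub_exp (hx.trans hxy))
      fun s => ?_
    have := mul_le_mul_of_nonneg_right hxy s.2
    have := Real.exp_le_exp.2 (neg_le_neg this)
    simp only [NNReal.val_eq_coe] at this
    linarith
  linarith

/-- Concavity of `ψ` together with `ψ 0 = a ≥ 0`, obtained from convexity of `exp` under the
integral. -/
theorem IsLevyTriple.mul_le (h : IsLevyTriple ψ a b ν) {c x : ℝ} (hc0 : 0 ≤ c) (hc1 : c ≤ 1)
    (hx : 0 ≤ x) : c * ψ x ≤ ψ (c * x) := by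
  rw [h.eq x hx, h.eq (c * x) (mul_nonneg hc0 hx), mul_add, mul_add, ← integral_const_mul]
  have h1 := mul_le_of_le_one_left h.a_nonneg hc1
  have h2 : ∫ s : ℝ≥0, c * (1 - Real.exp (-(x * s))) ∂ν ≤
      ∫ s : ℝ≥0, (1 - Real.exp (-(c * x * s))) ∂ν := by
    refine integral_mono ((h.integrable_one_sub_exp hx).const_mul c)
      (h.integrable_one_sub_exp (mul_nonneg hc0 hx)) fun s => ?_
    have h3 := convexOn_exp.2 (mem_univ (-(x * (s : ℝ)))) (mem_univ 0) hc0
      (sub_nonneg.2 hc1) (by ring)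
    simp only [smul_eq_mul, mul_zero, add_zero, Real.exp_zero, mul_one] at h3
    rw [show c * -(x * (s : ℝ)) = -(c * x * s) by ring] at h3
    simp only
    linarith
  linarith

theorem IsLevyTriple.pos (h : IsLevyTriple ψ a b ν) (h1 : ψ 1 = 1) {x : ℝ} (hx : 0 < x) :
    0 < ψ x := by
  rcases le_total x 1 with hx1 | hx1
  · have := h.mul_le hx.le hx1 zero_le_one
    rw [h1, mul_one] at this
    linarith
  · linarith [h.mono zero_le_one hx1]

/-- The generating function of the coefficients `c(ψ, k)`. -/
theorem IsLevyTriple.hasSum_subordinationCoeff (h : IsLevyTriple ψ a b ν) {s : ℝ} (hs0 : 0 ≤ s)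
    (hs1 : s ≤ 1) :
    HasSum (fun k : ℕ => subordinationCoeff b ν (k + 1) * s ^ (k + 1)) (ψ 1 - ψ (1 - s)) := by
  have hpt : ∀ t : ℝ≥0, HasSum
      (fun k : ℕ => 1 / ((k + 1).factorial : ℝ) * ((t : ℝ) ^ (k + 1) * Real.exp (-(t : ℝ))) *
        s ^ (k + 1))
      ((1 - Real.exp (-(1 * t))) - (1 - Real.exp (-((1 - s) * t)))) := by
    intro t
    have h1 := NormedSpace.expSeries_div_hasSum_exp (𝔸 := ℝ) (s * t)
    rw [← Real.exp_eq_exp_ℝ] at h1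
    rw [← hasSum_nat_add_iff' 1] at h1
    have h2 := h1.mul_left (Real.exp (-(t : ℝ)))
    simp only [Finset.range_one, Finset.sum_singleton, pow_zero, Nat.factorial_zero, Nat.cast_one,
      div_one] at h2
    have h3 : (1 - Real.exp (-(1 * (t : ℝ)))) - (1 - Real.exp (-((1 - s) * t))) =
        Real.exp (-(t : ℝ)) * (Real.exp (s * t) - 1) := by
      rw [mul_sub, ← Real.exp_add]
      ring_nf
    rw [h3]
    refine h2.congr_fun fun k => ?_
    rw [mul_pow]
    ring
  have hnn : ∀ (k : ℕ) (t : ℝ≥0), 0 ≤ 1 / ((k + 1).factorial : ℝ) *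
      ((t : ℝ) ^ (k + 1) * Real.exp (-(t : ℝ))) * s ^ (k + 1) := fun k t => by positivity
  have hi1 := h.integrable_one_sub_exp zero_le_one
  have hi2 := h.integrable_one_sub_exp (sub_nonneg.2 hs1)
  -- The terms are non-negative, so they serve as their own dominating functions.
  have key := hasSum_integral_of_dominated_convergence (μ := ν)
    (F := fun (k : ℕ) (t : ℝ≥0) => 1 / ((k + 1).factorial : ℝ) *
      ((t : ℝ) ^ (k + 1) * Real.exp (-(t : ℝ))) * s ^ (k + 1))
    (f := fun t : ℝ≥0 => (1 - Real.exp (-(1 * t))) - (1 - Real.exp (-((1 - s) * t))))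
    (fun (k : ℕ) (t : ℝ≥0) => 1 / ((k + 1).factorial : ℝ) *
      ((t : ℝ) ^ (k + 1) * Real.exp (-(t : ℝ))) * s ^ (k + 1))
    (fun k => by fun_prop)
    (fun k => ae_of_all _ fun t => (Real.norm_of_nonneg (hnn k t)).le)
    (ae_of_all _ fun t => (hpt t).summable)
    ((hi1.sub hi2).congr (ae_of_all _ fun t => ((hpt t).tsum_eq).symm))
    (ae_of_all _ hpt)
  have hb : HasSum (fun k : ℕ => if k = 0 then b * s else 0) (b * s) := hasSum_ite_eq 0 (b * s)
  rw [integral_sub hi1 hi2] at key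
  have hval : ψ 1 - ψ (1 - s) = (∫ t : ℝ≥0, (1 - Real.exp (-(1 * t))) ∂ν) -
      (∫ t : ℝ≥0, (1 - Real.exp (-((1 - s) * t))) ∂ν) + b * s := by
    rw [h.eq 1 zero_le_one, h.eq (1 - s) (sub_nonneg.2 hs1)]
    ring
  rw [hval]
  refine (key.add hb).congr_fun fun k => ?_
  simp only [integral_mul_const, integral_const_mul, subordinationCoeff, Nat.add_eq_right]
  split_ifs with hk
  · subst hk; ring
  · ring

end TripleProperties

/-! ### Laplace transforms of the subordinator and of tails -/

section Steps

variable {Ω : Type*} [MeasurableSpace Ω]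

theorem measurable_discreteSubordinator {R : ℕ → Ω → ℕ} (hR : ∀ i, Measurable (R i)) (n : ℕ) :
    Measurable (discreteSubordinator R n) :=
  Finset.measurable_fun_sum _ fun i _ => hR i

variable {P : Measure Ω} [IsProbabilityMeasure P]
  {ψ : ℝ → ℝ} {a b : ℝ} {ν : Measure ℝ≥0} {R : ℕ → Ω → ℕ}

theorem hasSum_integral_pow {X : Ω → ℕ} (hX : Measurable X) {s : ℝ} (hs0 : 0 ≤ s) (hs1 : s ≤ 1) :
    HasSum (fun k : ℕ => P.real {ω | X ω = k} * s ^ k) (∫ ω, s ^ X ω ∂P) := by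
  have hp : IsProbabilityMeasure (P.map X) := Measure.isProbabilityMeasure_map hX.aemeasurable
  have hint : Integrable (fun k : ℕ => s ^ k) (P.map X) :=
    Integrable.of_bound (C := 1) (by fun_prop) (ae_of_all _ fun k => by
      rw [Real.norm_of_nonneg (by positivity)]
      exact pow_le_one₀ hs0 hs1)
  have h1 := hasSum_integral_iUnion (μ := P.map X) (f := fun k : ℕ => s ^ k)
    (s := fun k : ℕ => {k}) (fun k => measurableSet_singleton k)
    (fun i j hij => by simpa using hij) hint.integrableOn
  rw [iUnion_of_singleton, setIntegral_univ, integral_map hX.aemeasurable (by fun_prop)] at h1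
  refine h1.congr_fun ?_
  intro k
  rw [integral_singleton, smul_eq_mul, map_measureReal_apply hX (measurableSet_singleton k)]
  rfl

theorem IsIIDSteps.integral_pow (hR : IsIIDSteps P (subordinationCoeff b ν) R)
    (h : IsLevyTriple ψ a b ν) (hψ0 : ψ 0 = 0) (hψ1 : ψ 1 = 1) (i : ℕ) {s : ℝ} (hs0 : 0 ≤ s)
    (hs1 : s ≤ 1) : ∫ ω, s ^ R i ω ∂P = 1 - ψ (1 - s) := by
  have h1 : ∀ s : ℝ, 0 ≤ s → s ≤ 1 →
      ∫ ω, s ^ R i ω ∂P = P.real {ω | R i ω = 0} + (1 - ψ (1 - s)) := by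
    intro s hs0 hs1
    have h2 := hasSum_integral_pow (P := P) (hR.measurable i) hs0 hs1
    have h3 := h.hasSum_subordinationCoeff hs0 hs1
    rw [hψ1] at h3
    have h4 := (hasSum_nat_add_iff' 1).2 h2
    have h5 : (fun k : ℕ => P.real {ω | R i ω = k + 1} * s ^ (k + 1)) =
        fun k => subordinationCoeff b ν (k + 1) * s ^ (k + 1) := by
      ext k
      rw [hR.law i (k + 1) (by omega)]
    rw [h5] at h4
    have h6 := h4.unique h3
    simp only [Finset.range_one, Finset.sum_singleton, pow_zero, mul_one] at h6
    linarith
  -- The law is prescribed only for `k ≥ 1`; total mass one and `ψ 0 = 0` force `ℙ(R i = 0) = 0`.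
  have h2 := h1 1 zero_le_one le_rfl
  simp only [one_pow, integral_const, probReal_univ, smul_eq_mul, sub_self, hψ0] at h2
  rw [h1 s hs0 hs1]
  linarith

/-- The Laplace transform of the discrete subordinator. -/
theorem IsIIDSteps.integral_exp (hR : IsIIDSteps P (subordinationCoeff b ν) R)
    (h : IsLevyTriple ψ a b ν) (hψ0 : ψ 0 = 0) (hψ1 : ψ 1 = 1) (n : ℕ) {c : ℝ} (hc : 0 ≤ c) :
    ∫ ω, Real.exp (-(c * discreteSubordinator R n ω)) ∂P =
      (1 - ψ (1 - Real.exp (-c))) ^ n := by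
  have hind : iIndepFun (fun i ω => (R i ω : ℝ)) P :=
    hR.indep.comp (fun _ k => (k : ℝ)) fun _ => measurable_from_top
  have hm : ∀ i, Measurable fun ω => (R i ω : ℝ) := fun i =>
    measurable_from_top.comp (hR.measurable i)
  have h1 := hind.mgf_sum (t := -c) hm (Finset.range n)
  have h2 : ∀ i, mgf (fun ω => (R i ω : ℝ)) P (-c) = 1 - ψ (1 - Real.exp (-c)) := by
    intro i
    rw [← hR.integral_pow h hψ0 hψ1 i (Real.exp_pos _).le (Real.exp_le_one_iff.2 (by linarith)),
      mgf]
    refine integral_congr_ae (ae_of_all _ fun ω => ?_)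
    simp only
    rw [← Real.exp_nat_mul, mul_comm]
  simp only [h2, Finset.prod_const, Finset.card_range] at h1
  rw [← h1, mgf]
  refine integral_congr_ae (ae_of_all _ fun ω => ?_)
  simp [discreteSubordinator]

/-- The Laplace transform of the tail of a non-negative random variable. -/
theorem integral_exp_mul_tail {X : Ω → ℝ} (hX : Measurable X) (hX0 : ∀ ω, 0 ≤ X ω) {c : ℝ}
    (hc : 0 < c) :
    ∫ u in Ioi 0, Real.exp (-(c * u)) * P.real {ω | u < X ω} =
      (1 - ∫ ω, Real.exp (-(c * X ω)) ∂P) / c := by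
  have hg : ∀ x : ℝ, ∫ t in (0 : ℝ)..x, Real.exp (-(c * t)) = (1 - Real.exp (-(c * x))) / c := by
    intro x
    have := intervalIntegral.integral_comp_mul_left (fun t => Real.exp t) (c := -c) (a := 0)
      (b := x) (neg_ne_zero.2 hc.ne')
    simp only [neg_mul, integral_exp, mul_zero, Real.exp_zero, smul_eq_mul] at this
    rw [this]
    field_simp
    ring
  -- Layer-cake formula for the primitive of `exp (-(c * t))`.
  have h1 := lintegral_comp_eq_lintegral_meas_lt_mul P (f := X) (g := fun t => Real.exp (-(c * t)))
    (ae_of_all _ hX0) hX.aemeasurable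
    (fun t _ => Continuous.intervalIntegrable (by fun_prop) _ _)
    (ae_of_all _ fun t => (Real.exp_pos _).le)
  simp only [hg] at h1
  have hanti : Antitone fun u : ℝ => P.real {ω | u < X ω} := fun u v huv =>
    measureReal_mono fun ω (hω : v < X ω) => huv.trans_lt hω
  have hbound : ∀ ω, 0 ≤ 1 - Real.exp (-(c * X ω)) := fun ω => by
    linarith [exp_neg_mul_le_one hc.le (hX0 ω)]
  have hI : Integrable (fun ω => Real.exp (-(c * X ω))) P :=
    Integrable.of_bound (C := 1) (by fun_prop) (ae_of_all _ fun ω => by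
      rw [Real.norm_of_nonneg (Real.exp_pos _).le]
      exact exp_neg_mul_le_one hc.le (hX0 ω))
  have h2 : (1 - ∫ ω, Real.exp (-(c * X ω)) ∂P) / c =
      ∫ ω, (1 - Real.exp (-(c * X ω))) / c ∂P := by
    rw [integral_div, integral_sub (integrable_const _) hI]
    simp
  rw [h2, integral_eq_lintegral_of_nonneg_ae (ae_of_all _ fun ω => div_nonneg (hbound ω) hc.le)
    (by fun_prop), integral_eq_lintegral_of_nonneg_ae
    (ae_of_all _ fun u => mul_nonneg (Real.exp_pos _).le measureReal_nonneg)
    (((by fun_prop : Measurable fun u : ℝ => Real.exp (-(c * u))).mul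
      hanti.measurable).aestronglyMeasurable), h1]
  congr 1
  refine lintegral_congr fun u => ?_
  rw [ENNReal.ofReal_mul (Real.exp_pos _).le, ofReal_measureReal, mul_comm]

end Steps

/-! ### Asymptotics of the transforms -/

section Asymptotics

variable {ψ : ℝ → ℝ} {a b : ℝ} {ν : Measure ℝ≥0}

theorem IsRegularlyVaryingAtZero.tendsto_div {β : ℝ} (h : IsRegularlyVaryingAtZero ψ β) {c : ℝ}
    (hc : 0 < c) : Tendsto (fun t : ℝ => ψ (c / t) / ψ (1 / t)) atTop (𝓝 (c ^ β)) := by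
  obtain ⟨ℓ, hℓ, r, hr, heq⟩ := h
  have h1 := (hℓ c⁻¹ (inv_pos.2 hc)).const_mul (c ^ β)
  rw [mul_one] at h1
  refine h1.congr' ?_
  filter_upwards [eventually_gt_atTop 0, eventually_gt_atTop (c / r), eventually_gt_atTop (1 / r)]
    with t ht ht1 ht2
  have h2 : c / t < r := by
    rw [div_lt_iff₀ hr] at ht1
    rw [div_lt_iff₀ ht]
    linarith
  have h3 : 1 / t < r := by
    rw [div_lt_iff₀ hr] at ht2
    rw [div_lt_iff₀ ht]
    linarith
  have h4 : (1 / t) ^ β ≠ 0 := (Real.rpow_pos_of_pos (by positivity) β).ne'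
  rw [heq _ (by positivity) h2, heq _ (by positivity) h3, one_div_one_div, one_div_div,
    div_eq_mul_one_div c t, Real.mul_rpow hc.le (by positivity),
    show t / c = c⁻¹ * t by rw [div_eq_inv_mul], mul_right_comm, mul_comm _ ((1 / t) ^ β),
    mul_div_mul_left _ _ h4, mul_div_assoc]

/-- As `1 - exp (-(c / t))` lies below `c / t` with quotient tending to `1`, monotonicity bounds `ψ`
there from above and `IsLevyTriple.mul_le` from below. -/
theorem IsLevyTriple.tendsto_one_sub_exp_div {β : ℝ} (h : IsLevyTriple ψ a b ν) (hψ1 : ψ 1 = 1)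
    (hreg : IsRegularlyVaryingAtZero ψ β) {c : ℝ} (hc : 0 < c) :
    Tendsto (fun t : ℝ => ψ (1 - Real.exp (-(c / t))) / ψ (1 / t)) atTop (𝓝 (c ^ β)) := by
  have h1 := hreg.tendsto_div hc
  have h2 : Tendsto (fun t : ℝ => t * (1 - Real.exp (-(c / t))) / c * (ψ (c / t) / ψ (1 / t)))
      atTop (𝓝 (c ^ β)) := by
    have := ((tendsto_mul_one_sub_exp c).div_const c).mul h1
    rwa [div_self hc.ne', one_mul] at this
  refine tendsto_of_tendsto_of_tendsto_of_le_of_le' h2 h1 ?_ ?_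
  · filter_upwards [eventually_gt_atTop 0] with t ht
    have hct : 0 < c / t := by positivity
    have h3 : 0 < ψ (1 / t) := h.pos hψ1 (by positivity)
    have h4 : Real.exp (-(c / t)) ≤ 1 := Real.exp_le_one_iff.2 (by linarith)
    have h5 := Real.add_one_le_exp (-(c / t))
    rw [← mul_div_assoc]
    refine div_le_div_of_nonneg_right ?_ h3.le
    have h6 := h.mul_le (c := t * (1 - Real.exp (-(c / t))) / c) (x := c / t)
      (div_nonneg (mul_nonneg ht.le (by linarith)) hc.le)
      (by
        rw [div_le_one hc]
        calc t * (1 - Real.exp (-(c / t))) ≤ t * (c / t) := by gcongr; linarith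
          _ = c := by field_simp) hct.le
    refine h6.trans (le_of_eq ?_)
    congr 1
    field_simp
  · filter_upwards [eventually_gt_atTop 0] with t ht
    have hct : 0 < c / t := by positivity
    have h3 : 0 < ψ (1 / t) := h.pos hψ1 (by positivity)
    have h5 := Real.add_one_le_exp (-(c / t))
    refine div_le_div_of_nonneg_right (h.mono ?_ (by linarith)) h3.le
    linarith [Real.exp_le_one_iff.2 (show -(c / t) ≤ 0 by linarith)]

/-- With Bernoulli's bound `1 - (1 - p) ^ n ≤ n p` this shows `1 - (1 - p) ^ n ∼ n p` as `n p → 0`.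
-/
theorem div_one_add_le_one_sub_pow {p : ℝ} (hp0 : 0 ≤ p) (hp1 : p ≤ 1) (n : ℕ) :
    n * p / (1 + n * p) ≤ 1 - (1 - p) ^ n := by
  have hy : 0 ≤ n * p := by positivity
  have h1 : (1 - p) ^ n ≤ Real.exp (-(n * p)) := by
    rw [← mul_neg, Real.exp_nat_mul]
    exact pow_le_pow_left₀ (by linarith) (by linarith [Real.add_one_le_exp (-p)]) n
  have h2 : Real.exp (-(n * p)) ≤ 1 / (1 + n * p) := by
    rw [Real.exp_neg, ← one_div]
    exact one_div_le_one_div_of_le (by linarith) (by linarith [Real.add_one_le_exp (n * p)])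
  have h3 : n * p / (1 + n * p) = 1 - 1 / (1 + n * p) := by field_simp; ring
  linarith

/-- The filter along which `n → ∞`, `t → ∞` and `n ψ (1 / t) → 0`. -/
noncomputable abbrev jointFilter (ψ : ℝ → ℝ) : Filter (ℕ × ℝ) :=
  ((atTop : Filter ℕ) ×ˢ (atTop : Filter ℝ)) ⊓
    comap (fun q : ℕ × ℝ => (q.1 : ℝ) * ψ (1 / q.2)) (𝓝 0)

theorem tendsto_snd_jointFilter : Tendsto Prod.snd (jointFilter ψ) atTop :=
  tendsto_snd.mono_left inf_le_left

theorem tendsto_fst_jointFilter : Tendsto Prod.fst (jointFilter ψ) atTop :=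
  tendsto_fst.mono_left inf_le_left

theorem IsLevyTriple.tendsto_one_sub_pow {β : ℝ} (h : IsLevyTriple ψ a b ν) (hψ0 : ψ 0 = 0)
    (hψ1 : ψ 1 = 1) (hreg : IsRegularlyVaryingAtZero ψ β) {c : ℝ} (hc : 0 < c) :
    Tendsto (fun q : ℕ × ℝ => (1 - (1 - ψ (1 - Real.exp (-(c / q.2)))) ^ q.1) /
      (q.1 * ψ (1 / q.2))) (jointFilter ψ) (𝓝 (c ^ β)) := by
  have h1 := (h.tendsto_one_sub_exp_div hψ1 hreg hc).comp (tendsto_snd_jointFilter (ψ := ψ))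
  have hx : Tendsto (fun q : ℕ × ℝ => (q.1 : ℝ) * ψ (1 / q.2)) (jointFilter ψ) (𝓝 0) :=
    tendsto_comap.mono_left inf_le_right
  have h2 := h1.div ((hx.mul h1).const_add 1) (by simp)
  rw [zero_mul, add_zero, div_one] at h2
  have hev : ∀ᶠ q : ℕ × ℝ in jointFilter ψ, 0 < q.1 ∧ 0 < q.2 :=
    (tendsto_fst_jointFilter.eventually (eventually_gt_atTop 0)).and
      (tendsto_snd_jointFilter.eventually (eventually_gt_atTop 0))
  have hp : ∀ t : ℝ, 0 < t → 0 ≤ ψ (1 - Real.exp (-(c / t))) ∧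
      ψ (1 - Real.exp (-(c / t))) ≤ 1 := by
    intro t ht
    have hct : 0 < c / t := by positivity
    have h4 : 0 ≤ 1 - Real.exp (-(c / t)) := by
      linarith [Real.exp_le_one_iff.2 (show -(c / t) ≤ 0 by linarith)]
    refine ⟨?_, ?_⟩
    · rw [← hψ0]
      exact h.mono le_rfl h4
    · exact (h.mono h4 (by linarith [Real.exp_pos (-(c / t))])).trans_eq hψ1
  refine tendsto_of_tendsto_of_tendsto_of_le_of_le' h2 h1 ?_ ?_
  · filter_upwards [hev] with q hq
    have h3 : 0 < ψ (1 / q.2) := h.pos hψ1 (one_div_pos.2 hq.2)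
    have hn : (0 : ℝ) < q.1 := Nat.cast_pos.2 hq.1
    obtain ⟨hp0, hp1⟩ := hp q.2 hq.2
    have h5 := div_le_div_of_nonneg_right (div_one_add_le_one_sub_pow hp0 hp1 q.1)
      (mul_pos hn h3).le
    refine le_trans (le_of_eq ?_) h5
    simp only [Function.comp_apply, Pi.div_apply]
    field_simp
  · filter_upwards [hev] with q hq
    have h3 : 0 < ψ (1 / q.2) := h.pos hψ1 (one_div_pos.2 hq.2)
    have hn : (0 : ℝ) < q.1 := Nat.cast_pos.2 hq.1
    obtain ⟨hp0, hp1⟩ := hp q.2 hq.2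
    have h5 := one_add_mul_le_pow (show (-2 : ℝ) ≤ -ψ (1 - Real.exp (-(c / q.2))) by linarith) q.1
    rw [← sub_eq_add_neg] at h5
    rw [Function.comp_apply, div_le_div_iff₀ (mul_pos hn h3) h3]
    nlinarith

end Asymptotics

/-! ### The tail asymptotics -/

theorem theorem2p2 (α : ℝ) (hα0 : 0 < α) (hα2 : α < 2) (ψ : ℝ → ℝ) (hψ : IsBernstein ψ)
    (hψ0 : ψ 0 = 0) (hψ1 : ψ 1 = 1) (hreg : IsRegularlyVaryingAtZero ψ (α / 2)) :
    (∃ (a b : ℝ) (ν : Measure ℝ≥0), IsLevyTriple ψ a b ν) ∧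
    ∀ (a b : ℝ) (ν : Measure ℝ≥0), IsLevyTriple ψ a b ν →
    ∀ {Ω : Type*} [MeasurableSpace Ω] (P : Measure Ω) [IsProbabilityMeasure P] (R : ℕ → Ω → ℕ),
      IsIIDSteps P (subordinationCoeff b ν) R →
      Asymptotics.IsEquivalent
        (((atTop : Filter ℕ) ×ˢ (atTop : Filter ℝ)) ⊓
          comap (fun q : ℕ × ℝ => (q.1 : ℝ) * ψ (1 / q.2)) (𝓝 0))
        (fun q : ℕ × ℝ => P.real {ω | q.2 < (discreteSubordinator R q.1 ω : ℝ)})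
        (fun q : ℕ × ℝ => (q.1 : ℝ) * ψ (1 / q.2) / Real.Gamma (1 - α / 2)) := by
  refine ⟨hψ.exists_isLevyTriple hψ0, ?_⟩
  intro a b ν h Ω _ P _ R hR
  set β : ℝ := α / 2 with hβ
  have hβ1 : 0 < 1 - β := by rw [hβ]; linarith
  have hβ0 : 0 < β := by rw [hβ]; linarith
  have hΓ : 0 < Real.Gamma (1 - β) := Real.Gamma_pos_of_pos hβ1
  -- The absolute values here and in `F` give non-negativity for every `q`, as the Tauberian theorem
  -- requires; for `t > 0` they change nothing.
  set X : ℕ × ℝ → Ω → ℝ := fun q ω => (discreteSubordinator R q.1 ω : ℝ) / |q.2| with hX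
  have hXm : ∀ q, Measurable (X q) := fun q =>
    (measurable_from_top.comp (measurable_discreteSubordinator hR.measurable q.1)).div_const _
  have hX0 : ∀ q ω, 0 ≤ X q ω := fun q ω => by positivity
  set F : ℕ × ℝ → ℝ → ℝ := fun q u => P.real {ω | u < X q ω} / |(q.1 : ℝ) * ψ (1 / q.2)| with hF
  set G : ℝ → ℝ := fun u => u ^ (-β) / Real.Gamma (1 - β) with hG
  have hFanti : ∀ q, Antitone (F q) := fun q u v huv =>
    div_le_div_of_nonneg_right
      (measureReal_mono fun ω (hω : v < X q ω) => huv.trans_lt hω) (abs_nonneg _)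
  have hexp : IntegrableOn (fun u : ℝ => Real.exp (-u)) (Ioi 0) := by
    simpa using exp_neg_integrableOn_Ioi 0 one_pos
  have hlapG : ∀ c : ℝ, 0 < c → ∫ u in Ioi 0, Real.exp (-(c * u)) * G u = c ^ β / c := by
    intro c hc
    have h1 := Real.integral_rpow_mul_exp_neg_mul_Ioi hβ1 hc
    have h2 : ∀ u : ℝ, Real.exp (-(c * u)) * G u =
        u ^ (1 - β - 1) * Real.exp (-(c * u)) / Real.Gamma (1 - β) := by
      intro u
      rw [hG, show 1 - β - 1 = -β by ring]
      ring
    simp only [h2]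
    rw [integral_div, h1, mul_div_cancel_right₀ _ hΓ.ne', one_div, Real.inv_rpow hc.le,
      ← Real.rpow_neg hc.le, neg_sub, Real.rpow_sub hc, Real.rpow_one]
  have hlim : Tendsto (fun q => F q 1) (jointFilter ψ) (𝓝 (G 1)) := by
    refine tendsto_of_tendsto_laplace (fun q u _ => by positivity)
      (fun u hu => div_nonneg (Real.rpow_nonneg hu.le _) hΓ.le)
      (fun q => (hFanti q).antitoneOn _)
      (fun u hu v hv huv => div_le_div_of_nonneg_right
        (Real.rpow_le_rpow_of_nonpos hu huv (by linarith)) hΓ.le)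
      (fun q => ?_) ?_ (fun k => ?_) one_pos
      ((Real.continuousAt_rpow_const 1 _ (Or.inl one_ne_zero)).div_const _)
    · refine Integrable.mul_bdd (c := 1 / |(q.1 : ℝ) * ψ (1 / q.2)|) hexp
        (hFanti q).measurable.aestronglyMeasurable (ae_of_all _ fun u => ?_)
      rw [Real.norm_of_nonneg (by positivity)]
      exact div_le_div_of_nonneg_right measureReal_le_one (abs_nonneg _)
    · refine ((Real.GammaIntegral_convergent hβ1).div_const (Real.Gamma (1 - β))).congr
        (ae_of_all _ fun u => ?_)
      simp only
      rw [show 1 - β - 1 = -β by ring, mul_div_assoc]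
    · have hc : (0 : ℝ) < (k + 1 : ℕ) := by positivity
      generalize ((k + 1 : ℕ) : ℝ) = c at hc
      rw [hlapG c hc]
      refine ((h.tendsto_one_sub_pow hψ0 hψ1 hreg hc).div_const c).congr' ?_
      filter_upwards [tendsto_snd_jointFilter.eventually (eventually_gt_atTop 0)] with q hq
      have hψq : 0 < ψ (1 / q.2) := h.pos hψ1 (one_div_pos.2 hq)
      have h1 := integral_exp_mul_tail (P := P) (hXm q) (hX0 q) hc
      have h2 : ∫ ω, Real.exp (-(c * X q ω)) ∂P =
          (1 - ψ (1 - Real.exp (-(c / q.2)))) ^ q.1 := by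
        rw [← hR.integral_exp h hψ0 hψ1 q.1 (div_pos hc hq).le]
        refine integral_congr_ae (ae_of_all _ fun ω => ?_)
        simp only [hX, abs_of_pos hq]
        ring_nf
      simp only [hF, ← mul_div_assoc]
      rw [integral_div, h1, h2, abs_of_nonneg (by positivity), div_right_comm]
  have hG1 : G 1 * Real.Gamma (1 - β) = 1 := by
    simp only [hG, Real.one_rpow]
    field_simp
  -- For `t > 0` the quotient of the two sides is `F q 1 * Γ(1 - β)`.
  refine Asymptotics.isEquivalent_of_tendsto_one ?_
  have h2 := hlim.mul_const (Real.Gamma (1 - β))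
  rw [hG1] at h2
  refine h2.congr' ?_
  filter_upwards [tendsto_snd_jointFilter.eventually (eventually_gt_atTop 0)] with q hq
  have hψq : 0 < ψ (1 / q.2) := h.pos hψ1 (one_div_pos.2 hq)
  simp only [hF, hX, Pi.div_apply, abs_of_pos hq, one_lt_div hq]
  rw [abs_of_nonneg (by positivity), div_div_eq_mul_div, div_mul_eq_mul_div]
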